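/- A (simple) mixed graph $D$ consists of a finite vertex set $V$ and a set of edges such that any two distinct vertices are joined by at most one edge, each edge being either undirected or directed (an arc); loops are not allowed. Write $uv\in E(D)$ if $u,v$ are joined by an undirected edge or by an arc from $u$ to $v$. The Hermitian adjacency matrix $H(D)\in\mathbb{C}^{V\times V}$ has $(u,v)$-entry $1$ if $uv$ is an undirected edge, $i$ if there is an arc from $u$ to $v$, $-i$ if there is an arc from $v$ to $u$, and $0$ otherwise. The $H$-rank of $D$ is the rank of $H(D)$, and the eigenvalues of $D$ are those of $H(D)$, counted with multiplicity. The converse of $D$ is obtained by reversing all arcs. Let $V=V_1\cup V_{-1}\cup V_i\cup V_{-i}$ be a partition of the vertex set into four possibly empty sets, and say that $xy\in E(D)$ has type $(j,k)$ if $x\in V_j$ and $y\in V_k$. The partition is admissible if no undirected edge has type $(1,-1)$ or $(i,-i)$, and every edge of type $(1,i)$, $(i,-1)$, $(-1,-i)$ or $(-i,1)$ is undirected. In this case, let $S$ be the diagonal matrix with $S_{vv}=j$ for $v\in V_j$; the mixed graph $D'$ on $V$ with $H(D')=S^{-1}H(D)S$ is said to be obtained from $D$ by a four-way switching. Two mixed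 graphs on the same vertex set are switching equivalent if one can be obtained from the other by a finite sequence of four-way switchings and operations of taking the converse. When we say that $D$ is switching equivalent to one of the specific graphs below, we mean that $D$ is switching equivalent to an isomorphic copy of it. For integers $1\le a\le b$, $K_{a,b}$ denotes the complete bipartite graph, with all edges undirected. For integers $1\le a\le b\le c$, $\vec{C}_3(a,b,c)$ denotes the mixed graph whose vertex set is the disjoint union of sets $A,B,C$ with $|A|=a$, $|B|=b$, $|C|=c$ and whose edges are all arcs from $A$ to $B$, all arcs from $B$ to $C$ and all arcs from $C$ to $A$. For an integer $t\ge 0$, $F\cup tK_1$ denotes the disjoint union of $F$ with $t$ isolated vertices. Theorem. Let $D$ be a mixed graph of order $n$ and $H$-rank $2$. Then $D$ has exactly one positive eigenvalue $\rho$ (counted with multiplicity), and exactly one of the following holds: (1) $D$ is switching equivalent to $K_{a,b}\cup tK_1$ for some integers $1\le a\le b$ and $t\ge0$; (2) $D$ is switching equivalent to $\vec{C}_3(a,b,c)\cup tK_1$ for some integers $1\le a\le b\le c$ and $t\ge 0$. Moreover, whenever $a,b,t$ are as in (1), we have $n=a+b+t$ and $\rho^2=ab$; and whenever $a,b,c,t$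 are as in (2), we have $n=a+b+c+t$ and $\rho^2=ab+bc+ac$. Conversely, for all integers $t\ge 0$ and $1\le a\le b\le c$, the mixed graphs $K_{a,b}\cup tK_1$ and $\vec{C}_3(a,b,c)\cup tK_1$ have $H$-rank $2$, and each has exactly one positive eigenvalue $\rho$ (counted with multiplicity); their orders are $n=a+b+t$ and $n=a+b+c+t$, and $\rho^2=ab$ and $\rho^2=ab+bc+ac$, respectively. -/

import Mathlib

/-- A simple mixed graph on the vertex set `V`: a simple graph of undirected edges together with a
set of arcs, such that two vertices are joined by at most one undirected edge or arc (in particular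
there are no loops, no parallel edges and no pairs of opposite arcs). -/
structure MixedGraph (V : Type*) where
  /-- the undirected edges -/
  undirected : SimpleGraph V
  /-- `arc u v`: there is an arc with initial vertex `u` and terminal vertex `v` -/
  arc : V → V → Prop
  arc_asymm : ∀ u v, arc u v → ¬ arc v u
  arc_not_undirected : ∀ u v, arc u v → ¬ undirected.Adj u v

namespace MixedGraph

/-- `uv ∈ E(D)`: there is an undirected edge joining `u` and `v`, or an arc from `u` to `v`. -/
def Edge {V : Type*} (D : MixedGraph V) (u v : V) : Prop :=
  D.undirected.Adj u v ∨ D.arc u v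

open Classical in
/-- The Hermitian adjacency matrix of a mixed graph. -/
noncomputable def hermAdj {V : Type*} (D : MixedGraph V) : Matrix V V ℂ :=
  Matrix.of fun u v =>
    if D.Edge u v ∧ D.Edge v u then 1
    else if D.Edge u v ∧ ¬ D.Edge v u then Complex.I
    else if ¬ D.Edge u v ∧ D.Edge v u then -Complex.I
    else 0

theorem hermAdj_isHermitian {V : Type*} (D : MixedGraph V) : D.hermAdj.IsHermitian := by
  refine Matrix.IsHermitian.ext fun u v => ?_
  by_cases h1 : D.Edge u v <;> by_cases h2 : D.Edge v u <;> simp [hermAdj, h1, h2]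

/-- The `H`-rank. -/
noncomputable def hRank {V : Type*} [Fintype V] (D : MixedGraph V) : ℕ := D.hermAdj.rank

open Classical in
/-- The `H`-spectrum: the multiset of the (real) eigenvalues of the Hermitian adjacency matrix,
counted with multiplicity. -/
noncomputable def hSpectrum {V : Type*} [Fintype V] (D : MixedGraph V) : Multiset ℝ :=
  Finset.univ.val.map D.hermAdj_isHermitian.eigenvalues

open Classical in
/-- `ρ` is positive, it is a simple eigenvalue, and there is no other positive eigenvalue. -/
def IsThePositiveEigenvalue {V : Type*} [Fintype V] (D : MixedGraph V) (ρ : ℝ) : Prop :=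
  D.hSpectrum.filter (fun x => 0 < x) = {ρ}

/-- The converse: all arcs are reversed. -/
def converse {V : Type*} (D : MixedGraph V) : MixedGraph V where
  undirected := D.undirected
  arc u v := D.arc v u
  arc_asymm u v h := D.arc_asymm v u h
  arc_not_undirected u v h h' := D.arc_not_undirected v u h h'.symm

/-- Admissibility of the partition of the vertices into `V_j = {v | σ v = j}`, `j ∈ {1, -1, i, -i}`.
An edge `xy` has type `(j, k)` if `x ∈ V_j` and `y ∈ V_k`; undirected edges play the role of
digons. No undirected edge has type `(1, -1)` or `(i, -i)`, and every edge of type `(1, i)`,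
`(i, -1)`, `(-1, -i)` or `(-i, 1)` is undirected. -/
def Admissible {V : Type*} (D : MixedGraph V) (σ : V → ℂ) : Prop :=
  (∀ x y, (σ x = 1 ∧ σ y = -1 ∨ σ x = Complex.I ∧ σ y = -Complex.I) →
      ¬ D.undirected.Adj x y) ∧
  (∀ x y, (σ x = 1 ∧ σ y = Complex.I ∨ σ x = Complex.I ∧ σ y = -1 ∨
        σ x = -1 ∧ σ y = -Complex.I ∨ σ x = -Complex.I ∧ σ y = 1) →
      D.Edge x y → D.undirected.Adj x y)

/-- `D'` is obtained from `D` by a four-way switching: `H(D') = S⁻¹ H(D) S` for a diagonal matrix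
`S = diag(σ)` with entries in `{1, -1, i, -i}` whose associated partition is admissible. -/
def FourWaySwitching {V : Type*} (D D' : MixedGraph V) : Prop :=
  ∃ σ : V → ℂ,
    (∀ v, σ v = 1 ∨ σ v = -1 ∨ σ v = Complex.I ∨ σ v = -Complex.I) ∧
    D.Admissible σ ∧
    ∀ u v, D'.hermAdj u v = (σ u)⁻¹ * D.hermAdj u v * σ v

/-- Switching equivalence of mixed graphs on the same vertex set: `D'` is obtained from `D` by a
finite sequence of four-way switchings and operations of taking the converse. -/
def SwitchingEquivalent {V : Type*} (D D' : MixedGraph V) : Prop :=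
  Relation.ReflTransGen
    (fun D₁ D₂ : MixedGraph V => D₁.FourWaySwitching D₂ ∨ D₂ = D₁.converse) D D'

/-- Isomorphism of mixed graphs. -/
def Isomorphic {V W : Type*} (D : MixedGraph V) (F : MixedGraph W) : Prop :=
  ∃ e : V ≃ W,
    (∀ u v, F.undirected.Adj (e u) (e v) ↔ D.undirected.Adj u v) ∧
    (∀ u v, F.arc (e u) (e v) ↔ D.arc u v)

/-- `D` is switching equivalent to (a copy on its own vertex set of) the mixed graph `F`, which
is regarded up to isomorphism. -/
def SwitchingEquivalentTo {V W : Type*} (D : MixedGraph V) (F : MixedGraph W) : Prop :=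
  ∃ D' : MixedGraph V, D.SwitchingEquivalent D' ∧ D'.Isomorphic F

/-- A simple graph as a mixed graph without arcs. -/
def ofSimpleGraph {V : Type*} (G : SimpleGraph V) : MixedGraph V where
  undirected := G
  arc _ _ := False
  arc_asymm _ _ h := h.elim
  arc_not_undirected _ _ h := h.elim

/-- `D ∪ tK₁`: the disjoint union of `D` with `t` isolated vertices. -/
def addIsolated {V : Type*} (D : MixedGraph V) (t : ℕ) : MixedGraph (V ⊕ Fin t) where
  undirected := SimpleGraph.sum D.undirected (⊥ : SimpleGraph (Fin t))
  arc x y :=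
    match x, y with
    | Sum.inl u, Sum.inl v => D.arc u v
    | _, _ => False
  arc_asymm := by
    rintro (u | u) (v | v) h
    · exact D.arc_asymm u v h
    all_goals exact h.elim
  arc_not_undirected := by
    rintro (u | u) (v | v) h
    · exact D.arc_not_undirected u v h
    all_goals exact h.elim

/-- The complete bipartite graph `K_{a,b}` (all edges undirected). -/
def completeBipartite (a b : ℕ) : MixedGraph (Fin a ⊕ Fin b) :=
  ofSimpleGraph (completeBipartiteGraph (Fin a) (Fin b))

/-- The clockwise complete tripartite digraph `C₃(a,b,c)` with parts `A`, `B`, `C` of sizes `a`,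
`b`, `c`: its edges are all arcs from `A` to `B`, from `B` to `C`, and from `C` to `A`. -/
def clockwiseTripartite (a b c : ℕ) : MixedGraph ((Fin a ⊕ Fin b) ⊕ Fin c) where
  undirected := ⊥
  arc x y :=
    match x, y with
    | Sum.inl (Sum.inl _), Sum.inl (Sum.inr _) => True
    | Sum.inl (Sum.inr _), Sum.inr _ => True
    | Sum.inr _, Sum.inl (Sum.inl _) => True
    | _, _ => False
  arc_asymm := by
    rintro ((u | u) | u) ((v | v) | v) <;> simp
  arc_not_undirected _ _ _ h := h

end MixedGraph

open scoped ComplexConjugate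

/-! ### Entries of the matrix and their behaviour under switching -/

namespace MixedGraph

variable {V W : Type*}

/-! Fix an edge `u v` of a mixed graph of rank 2. Every 3×3 minor bordering the block on `u`, `v`
vanishes, and this gives `H x y = p x * conj (q y) + q x * conj (p y)`, where `p`, `q` are columns
`v` and `u` up to a phase, with entries zero or fourth roots of unity
(`hermAdj_eq_of_hRank_eq_two`). The zero diagonal forces `q = ±i p` wherever both are nonzero
(`eq_or_eq`), and the two signs cannot coexist, because they would produce an entry of modulus 2
(`not_and`). So the nonisolated vertices form two classes, or three when the supports overlap.
Dividing out the phase at each vertex is a four-way switching to the complete bipartite or the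
cyclic tripartite graph.

Rank 2 and trace 0 make the nonzero eigenvalues `±ρ`, and the trace of `H ^ 2` gives `2ρ² = ∑ |H u
v|²`. Switching and converse preserve all `|H u v|`, hence this sum and also the presence of
triangles; the latter separates the two families. -/

theorem edge_and_edge_iff (D : MixedGraph V) (u v : V) :
    D.Edge u v ∧ D.Edge v u ↔ D.undirected.Adj u v := by
  have h1 := D.arc_asymm u v
  have h2 := D.undirected.adj_comm u v
  unfold Edge
  tauto

theorem hermAdj_of_adj (D : MixedGraph V) {u v : V} (h : D.undirected.Adj u v) :
    D.hermAdj u v = 1 := by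
  have := (D.edge_and_edge_iff u v).2 h
  simp [hermAdj, this]

theorem hermAdj_of_arc (D : MixedGraph V) {u v : V} (h : D.arc u v) :
    D.hermAdj u v = Complex.I := by
  have h1 : D.Edge u v := Or.inr h
  have h2 : ¬ D.Edge v u := fun h2 =>
    D.arc_not_undirected u v h ((D.edge_and_edge_iff u v).1 ⟨h1, h2⟩)
  simp [hermAdj, h1, h2]

theorem hermAdj_of_arc_symm (D : MixedGraph V) {u v : V} (h : D.arc v u) :
    D.hermAdj u v = -Complex.I := by
  rw [← D.hermAdj_isHermitian.apply, D.hermAdj_of_arc h]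
  simp

theorem hermAdj_of_not (D : MixedGraph V) {u v : V} (h : ¬ D.undirected.Adj u v)
    (h1 : ¬ D.arc u v) (h2 : ¬ D.arc v u) : D.hermAdj u v = 0 := by
  have h3 : ¬ D.undirected.Adj v u := fun h' => h h'.symm
  simp [hermAdj, Edge, h, h1, h2, h3]

theorem hermAdj_cases (D : MixedGraph V) (u v : V) :
    D.hermAdj u v = 0 ∨ D.hermAdj u v = 1 ∨ D.hermAdj u v = Complex.I ∨
      D.hermAdj u v = -Complex.I := by
  by_cases h : D.undirected.Adj u v
  · simp [D.hermAdj_of_adj h]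
  by_cases h1 : D.arc u v
  · simp [D.hermAdj_of_arc h1]
  by_cases h2 : D.arc v u
  · simp [D.hermAdj_of_arc_symm h2]
  · simp [D.hermAdj_of_not h h1 h2]

theorem hermAdj_self (D : MixedGraph V) (u : V) : D.hermAdj u u = 0 :=
  D.hermAdj_of_not D.undirected.irrefl (fun h => D.arc_asymm _ _ h h)
    (fun h => D.arc_asymm _ _ h h)

/-- The edge types that admissibility forbids are ones that a switching would turn into an entry
`-1`, so this exclusion makes admissibility automatic. -/
theorem hermAdj_ne_neg_one (D : MixedGraph V) (u v : V) : D.hermAdj u v ≠ -1 := by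
  rcases D.hermAdj_cases u v with h | h | h | h <;> rw [h] <;> simp [Complex.ext_iff]
  norm_num

theorem converse_hermAdj (D : MixedGraph V) (u v : V) :
    D.converse.hermAdj u v = D.hermAdj v u := by
  by_cases h : D.undirected.Adj v u
  · rw [D.hermAdj_of_adj h, D.converse.hermAdj_of_adj h.symm]
  by_cases h1 : D.arc v u
  · rw [D.hermAdj_of_arc h1, D.converse.hermAdj_of_arc h1]
  by_cases h2 : D.arc u v
  · rw [D.hermAdj_of_arc_symm h2, D.converse.hermAdj_of_arc_symm h2]
  · rw [D.hermAdj_of_not h h1 h2, D.converse.hermAdj_of_not (fun h' => h h'.symm) h1 h2]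

/-- Switching by `σ` is admissible as soon as its result is the Hermitian adjacency matrix of a
mixed graph. -/
theorem fourWaySwitching_of_hermAdj_eq {D D' : MixedGraph V} (σ : V → ℂ)
    (hσ : ∀ v, σ v = 1 ∨ σ v = -1 ∨ σ v = Complex.I ∨ σ v = -Complex.I)
    (h : ∀ u v, D'.hermAdj u v = (σ u)⁻¹ * D.hermAdj u v * σ v) : D.FourWaySwitching D' := by
  refine ⟨σ, hσ, ⟨fun x y hxy hadj => ?_, fun x y hxy hE => ?_⟩, h⟩
  · apply D'.hermAdj_ne_neg_one x y
    rw [h, D.hermAdj_of_adj hadj]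
    rcases hxy with ⟨h1, h2⟩ | ⟨h1, h2⟩ <;> rw [h1, h2] <;> simp
  · refine hE.resolve_right fun harc => ?_
    apply D'.hermAdj_ne_neg_one x y
    rw [h, D.hermAdj_of_arc harc]
    rcases hxy with ⟨h1, h2⟩ | ⟨h1, h2⟩ | ⟨h1, h2⟩ | ⟨h1, h2⟩ <;> rw [h1, h2] <;> simp

theorem FourWaySwitching.normSq_hermAdj {D D' : MixedGraph V} (h : D.FourWaySwitching D')
    (u v : V) : Complex.normSq (D'.hermAdj u v) = Complex.normSq (D.hermAdj u v) := by
  obtain ⟨σ, hσ, -, h⟩ := h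
  have hn : ∀ v, Complex.normSq (σ v) = 1 := fun v => by
    rcases hσ v with h | h | h | h <;> rw [h] <;> simp
  rw [h, map_mul, map_mul, map_inv₀, hn, hn]
  simp

theorem SwitchingEquivalent.normSq_hermAdj {D D' : MixedGraph V} (h : D.SwitchingEquivalent D')
    (u v : V) : Complex.normSq (D'.hermAdj u v) = Complex.normSq (D.hermAdj u v) := by
  induction h with
  | refl => rfl
  | tail _ h ih =>
    rw [← ih]
    rcases h with h | h
    · exact h.normSq_hermAdj u v
    · rw [h, converse_hermAdj, ← (hermAdj_isHermitian _).apply]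
      simp

theorem Isomorphic.hermAdj_eq {D : MixedGraph V} {F : MixedGraph W} (h : D.Isomorphic F) :
    ∃ e : V ≃ W, ∀ u v, D.hermAdj u v = F.hermAdj (e u) (e v) := by
  obtain ⟨e, h1, h2⟩ := h
  refine ⟨e, fun u v => ?_⟩
  by_cases h : D.undirected.Adj u v
  · rw [D.hermAdj_of_adj h, F.hermAdj_of_adj ((h1 u v).2 h)]
  by_cases h3 : D.arc u v
  · rw [D.hermAdj_of_arc h3, F.hermAdj_of_arc ((h2 u v).2 h3)]
  by_cases h4 : D.arc v u
  · rw [D.hermAdj_of_arc_symm h4, F.hermAdj_of_arc_symm ((h2 v u).2 h4)]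
  · rw [D.hermAdj_of_not h h3 h4, F.hermAdj_of_not (mt (h1 u v).1 h) (mt (h2 u v).1 h3)
      (mt (h2 v u).1 h4)]

/-- Up to a relabelling of the vertices, switching equivalence preserves the underlying graph. -/
theorem SwitchingEquivalentTo.normSq_hermAdj {D : MixedGraph V} {F : MixedGraph W}
    (h : D.SwitchingEquivalentTo F) :
    ∃ e : V ≃ W, ∀ u v,
      Complex.normSq (D.hermAdj u v) = Complex.normSq (F.hermAdj (e u) (e v)) := by
  obtain ⟨D', h1, h2⟩ := h
  obtain ⟨e, he⟩ := h2.hermAdj_eq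
  exact ⟨e, fun u v => by rw [← he, h1.normSq_hermAdj]⟩

end MixedGraph

/-! ### Traces and the spectrum in rank 2 -/

theorem Matrix.IsHermitian.trace_mul_self_eq_sum_eigenvalues_sq {n : Type*} [Fintype n]
    [DecidableEq n] {A : Matrix n n ℂ} (hA : A.IsHermitian) :
    (A * A).trace = ∑ i, (hA.eigenvalues i : ℂ) ^ 2 := by
  conv_lhs => rw [hA.spectral_theorem, ← map_mul, Unitary.conjStarAlgAut_apply,
    Matrix.trace_mul_cycle]
  simp [Matrix.trace, Matrix.diagonal_mul_diagonal, sq]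

theorem Matrix.IsHermitian.trace_mul_self_eq_sum_normSq {n : Type*} [Fintype n]
    {A : Matrix n n ℂ} (hA : A.IsHermitian) :
    (A * A).trace = ((∑ i, ∑ j, Complex.normSq (A i j) : ℝ) : ℂ) := by
  push_cast
  refine Finset.sum_congr rfl fun i _ => ?_
  rw [Matrix.diag_apply, Matrix.mul_apply]
  refine Finset.sum_congr rfl fun j _ => ?_
  rw [← hA.apply j i, Complex.star_def, Complex.mul_conj]

namespace MixedGraph

variable {V : Type*} [Fintype V]

/-- The nonzero eigenvalues of a mixed graph of `H`-rank 2 are `±ρ`, where `ρ ^ 2` is the number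
of edges. -/
theorem exists_isThePositiveEigenvalue (D : MixedGraph V) (h : D.hRank = 2) :
    ∃ ρ : ℝ, D.IsThePositiveEigenvalue ρ ∧
      2 * ρ ^ 2 = ∑ u, ∑ v, Complex.normSq (D.hermAdj u v) := by
  classical
  have hA := D.hermAdj_isHermitian
  have htr : ∑ i, hA.eigenvalues i = 0 := by
    have h0 : D.hermAdj.trace = 0 := by simp [Matrix.trace, hermAdj_self]
    have h1 := hA.trace_eq_sum_eigenvalues
    rw [h0] at h1
    apply Complex.ofReal_injective
    push_cast
    exact h1.symm
  have hsq : ∑ i, hA.eigenvalues i ^ 2 = ∑ u, ∑ v, Complex.normSq (D.hermAdj u v) := by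
    have h1 := hA.trace_mul_self_eq_sum_eigenvalues_sq
    rw [hA.trace_mul_self_eq_sum_normSq] at h1
    exact_mod_cast h1.symm
  have hcard : (Finset.univ.filter fun i => hA.eigenvalues i ≠ 0).card = 2 := by
    rw [← Fintype.card_subtype, ← hA.rank_eq_card_non_zero_eigs]
    exact h
  obtain ⟨x, y, hxy, hs⟩ := Finset.card_eq_two.1 hcard
  have hx : hA.eigenvalues x ≠ 0 := by
    have : x ∈ Finset.univ.filter fun i => hA.eigenvalues i ≠ 0 := by simp [hs]
    simpa using this
  have h0 : ∀ i, i ∉ ({x, y} : Finset V) → hA.eigenvalues i = 0 := fun i hi => by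
    rw [← hs] at hi
    simpa using hi
  have hsum : hA.eigenvalues x + hA.eigenvalues y = 0 := by
    rw [← htr, ← Finset.sum_pair hxy]
    exact Finset.sum_subset (Finset.subset_univ _) fun i _ hi => h0 i hi
  have hsum2 : hA.eigenvalues x ^ 2 + hA.eigenvalues y ^ 2 =
      ∑ u, ∑ v, Complex.normSq (D.hermAdj u v) := by
    rw [← hsq, ← Finset.sum_pair (f := fun i => hA.eigenvalues i ^ 2) hxy]
    exact Finset.sum_subset (Finset.subset_univ _) fun i _ hi => by rw [h0 i hi]; simp
  -- Stated for arbitrary `x`, `y`, since either of the two indices may carry the positive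
  -- eigenvalue.
  have key : ∀ x y, hA.eigenvalues x + hA.eigenvalues y = 0 → 0 < hA.eigenvalues x →
      (∀ i, i ∉ ({x, y} : Finset V) → hA.eigenvalues i = 0) →
      D.IsThePositiveEigenvalue (hA.eigenvalues x) := by
    intro x y hsum hpos h0
    have hf : (Finset.univ.filter fun i => 0 < hA.eigenvalues i) = {x} := by
      ext i
      simp only [Finset.mem_filter, Finset.mem_univ, true_and, Finset.mem_singleton]
      refine ⟨fun hi => ?_, fun hi => hi ▸ hpos⟩
      by_contra hne
      rcases eq_or_ne i y with rfl | hny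
      · linarith
      · rw [h0 i (by simp [hne, hny])] at hi
        exact lt_irrefl _ hi
    have hf' := congrArg Finset.val hf
    rw [Finset.filter_val] at hf'
    unfold IsThePositiveEigenvalue hSpectrum
    rw [Multiset.filter_map]
    convert congrArg (Multiset.map hA.eigenvalues) hf' using 1
    congr
    all_goals simp
  rcases lt_or_gt_of_ne hx with hlt | hgt
  · refine ⟨hA.eigenvalues y, key y x (by linarith) (by linarith) (fun i hi => h0 i ?_), ?_⟩
    · rwa [Finset.pair_comm]
    · rw [← hsum2, eq_neg_of_add_eq_zero_left hsum]; ring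
  · refine ⟨hA.eigenvalues x, key x y hsum hgt h0, ?_⟩
    rw [← hsum2, eq_neg_of_add_eq_zero_right hsum]; ring

/-! ### Minors and rank-two factorisations -/

theorem two_le_hRank (D : MixedGraph V) {u v : V} (h : D.hermAdj u v ≠ 0) : 2 ≤ D.hRank := by
  -- The principal minor on `u`, `v` is `-|H u v|²`.
  have hM : IsUnit (D.hermAdj.submatrix ![u, v] ![u, v]) := by
    rw [Matrix.isUnit_iff_isUnit_det, Matrix.det_fin_two, isUnit_iff_ne_zero]
    have h' : D.hermAdj v u ≠ 0 := by rw [← D.hermAdj_isHermitian.apply]; simpa using h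
    simp [hermAdj_self, h, h']
  have h1 := Matrix.rank_of_isUnit _ hM
  have h2 := D.hermAdj.rank_submatrix_le ![u, v] ![u, v]
  rw [h1, Fintype.card_fin] at h2
  exact h2

theorem hRank_eq_two_of_hermAdj_eq (D : MixedGraph V) {u v : V} (h : D.hermAdj u v ≠ 0)
    (p q : V → ℂ) (hpq : ∀ x y, D.hermAdj x y = p x * conj (q y) + q x * conj (p y)) :
    D.hRank = 2 := by
  refine le_antisymm ?_ (D.two_le_hRank h)
  have : D.hermAdj = (Matrix.of fun x => ![p x, q x]) *
      (Matrix.of ![fun y => conj (q y), fun y => conj (p y)]) := by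
    ext x y
    simp [hpq, Matrix.mul_apply]
  rw [hRank, this]
  exact (Matrix.rank_mul_le_left _ _).trans ((Matrix.rank_le_card_width _).trans_eq (Fintype.card_fin 2))

theorem exists_hermAdj_ne_zero (D : MixedGraph V) (h : D.hRank = 2) :
    ∃ u v, D.hermAdj u v ≠ 0 := by
  by_contra! h0
  have : D.hermAdj = 0 := by ext u v; exact h0 u v
  simp [hRank, this] at h

/-- In a mixed graph of `H`-rank 2, the rows of two adjacent vertices span the row space. -/
theorem hermAdj_eq_of_hRank_eq_two (D : MixedGraph V) (h : D.hRank = 2) {u v : V}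
    (huv : D.hermAdj u v ≠ 0) (w x : V) :
    D.hermAdj w x = D.hermAdj w v * conj (D.hermAdj u v) * conj (D.hermAdj x u) +
      D.hermAdj w u * conj (D.hermAdj x v * conj (D.hermAdj u v)) := by
  -- Expanding this minor expresses `H w x * |H u v|²` through the rows and columns of `u` and `v`;
  -- as `|H u v| = 1`, no division is needed.
  have hdet : (D.hermAdj.submatrix ![w, u, v] ![x, u, v]).det = 0 := by
    by_contra hne
    have h1 := Matrix.rank_of_isUnit _
      ((Matrix.isUnit_iff_isUnit_det _).2 (isUnit_iff_ne_zero.2 hne))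
    have h2 := D.hermAdj.rank_submatrix_le ![w, u, v] ![x, u, v]
    rw [h1] at h2
    have h3 : D.hermAdj.rank = 2 := h
    rw [h3] at h2
    simp at h2
  rw [Matrix.det_fin_three] at hdet
  simp [hermAdj_self] at hdet
  have hH := fun a b => D.hermAdj_isHermitian.apply a b
  simp only [Complex.star_def] at hH
  have hn : D.hermAdj u v * conj (D.hermAdj u v) = 1 := by
    rcases D.hermAdj_cases u v with h | h | h | h <;> simp_all
  rw [map_mul, hH, hH, hH, hH]
  rw [hH] at hn
  linear_combination (-D.hermAdj w x) * hn - hdet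

end MixedGraph

/-! ### Normal forms and the switching that reaches them -/

namespace MixedGraph

variable {V W : Type*}

/-- The complete bipartite graph between the vertices labelled `0` and `1`. -/
def bipartiteOfLabel (l : V → Fin 3) : MixedGraph V :=
  ofSimpleGraph
    { Adj := fun u v => l u = 0 ∧ l v = 1 ∨ l u = 1 ∧ l v = 0
      symm := ⟨fun u v h => by tauto⟩
      loopless := ⟨fun u h => by rcases h with ⟨h1, h2⟩ | ⟨h1, h2⟩ <;> simp [h1] at h2⟩ }

/-- The complete tripartite digraph with arcs from label `0` to `1`, `1` to `2`, and `2` to `0`. -/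
def cyclicOfLabel (l : V → Fin 4) : MixedGraph V where
  undirected := ⊥
  arc u v := l u = 0 ∧ l v = 1 ∨ l u = 1 ∧ l v = 2 ∨ l u = 2 ∧ l v = 0
  arc_asymm u v h := by
    rcases h with ⟨h1, h2⟩ | ⟨h1, h2⟩ | ⟨h1, h2⟩ <;> simp [h1, h2]
  arc_not_undirected _ _ _ h := h

theorem bipartiteOfLabel_hermAdj (l : V → Fin 3) (u v : V) :
    (bipartiteOfLabel l).hermAdj u v =
      (![1, 0, 0] (l u) : ℂ) * conj (![0, 1, 0] (l v)) +
        ![0, 1, 0] (l u) * conj (![1, 0, 0] (l v)) := by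
  have hl : ∀ i : Fin 3, i = 0 ∨ i = 1 ∨ i = 2 := by decide
  rcases hl (l u) with hu | hu | hu <;> rcases hl (l v) with hv | hv | hv <;>
    simp [hermAdj, bipartiteOfLabel, Edge, ofSimpleGraph, hu, hv]

/-- The vectors satisfy `q = -i p` on label `2`, the only label where both are nonzero; that
relation makes the entries within this class cancel. -/
theorem cyclicOfLabel_hermAdj (l : V → Fin 4) (u v : V) :
    (cyclicOfLabel l).hermAdj u v =
      (![1, 0, -1, 0] (l u) : ℂ) * conj (![0, -Complex.I, Complex.I, 0] (l v)) +
        ![0, -Complex.I, Complex.I, 0] (l u) * conj (![1, 0, -1, 0] (l v)) := by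
  simp only [hermAdj, cyclicOfLabel, Edge, Matrix.of_apply, SimpleGraph.bot_adj, false_or]
  generalize l u = i
  generalize l v = j
  fin_cases i <;> fin_cases j <;> simp

/-- A relation between two rank-two decompositions that differ by the factor `σ`. -/
theorem hermAdj_switch_of_decomposition {D : MixedGraph V} {p q P Q σ : V → ℂ}
    (hpq : ∀ x y, D.hermAdj x y = p x * conj (q y) + q x * conj (p y))
    (hσ : ∀ v, σ v = 1 ∨ σ v = -1 ∨ σ v = Complex.I ∨ σ v = -Complex.I)
    (hp : ∀ v, p v = σ v * P v) (hq : ∀ v, q v = σ v * Q v) (u v : V) :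
    P u * conj (Q v) + Q u * conj (P v) = (σ u)⁻¹ * D.hermAdj u v * σ v := by
  have h0 : σ u ≠ 0 := by rcases hσ u with h | h | h | h <;> simp [h]
  have h1 : conj (σ v) * σ v = 1 := by rcases hσ v with h | h | h | h <;> simp [h]
  rw [hpq, hp, hp, hq, hq, map_mul, map_mul]
  field_simp
  linear_combination (-(P u * conj (Q v) + conj (P v) * Q u)) * h1

/-- A Hermitian decomposition of rank two of the adjacency matrix with entries that are zero or
fourth roots of unity, and such that neither vector has its support in that of the other. -/
structure RankTwoDecomposition (D : MixedGraph V) (p q : V → ℂ) : Prop where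
  hermAdj_eq : ∀ x y, D.hermAdj x y = p x * conj (q y) + q x * conj (p y)
  left_root : ∀ v, p v ≠ 0 → p v = 1 ∨ p v = -1 ∨ p v = Complex.I ∨ p v = -Complex.I
  right_root : ∀ v, q v ≠ 0 → q v = 1 ∨ q v = -1 ∨ q v = Complex.I ∨ q v = -Complex.I
  exists_left : ∃ v, p v ≠ 0 ∧ q v = 0
  exists_right : ∃ v, p v = 0 ∧ q v ≠ 0

namespace RankTwoDecomposition

variable {D : MixedGraph V} {p q : V → ℂ}

theorem symm (h : D.RankTwoDecomposition p q) : D.RankTwoDecomposition q p where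
  hermAdj_eq x y := by rw [h.hermAdj_eq, add_comm]
  left_root := h.right_root
  right_root := h.left_root
  exists_left := let ⟨v, h1, h2⟩ := h.exists_right; ⟨v, h2, h1⟩
  exists_right := let ⟨v, h1, h2⟩ := h.exists_left; ⟨v, h2, h1⟩

/-- The diagonal entry is `2 Re (p v * conj (q v)) = 0`, so the two units differ by a factor `±i`.
The second sign is written with `p` and `q` exchanged to match `symm`. -/
theorem eq_or_eq (h : D.RankTwoDecomposition p q) {v : V} (hp : p v ≠ 0) (hq : q v ≠ 0) :
    q v = -Complex.I * p v ∨ p v = -Complex.I * q v := by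
  have h0 := h.hermAdj_eq v v
  rw [hermAdj_self] at h0
  rcases h.left_root v hp with h1 | h1 | h1 | h1 <;>
    rcases h.right_root v hq with h2 | h2 | h2 | h2 <;> rw [h1, h2] at h0 ⊢ <;>
      first
      | (left; simp; done)
      | (right; simp; done)
      | (exfalso; simp [Complex.ext_iff] at h0; norm_num at h0)

/-- With opposite signs at `v` and `w` the two terms of `H v w` coincide and add up to modulus 2. -/
theorem not_and (h : D.RankTwoDecomposition p q) {v w : V} (hv : q v = -Complex.I * p v)
    (hv0 : p v ≠ 0) (hw : p w = -Complex.I * q w) (hw0 : q w ≠ 0) : False := by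
  have hv1 : p v = Complex.I * q v := by
    rw [hv]; linear_combination p v * Complex.I_sq
  have hqv : q v ≠ 0 := by rw [hv]; simp [hv0]
  have hH : D.hermAdj v w = 2 * Complex.I * (q v * conj (q w)) := by
    rw [h.hermAdj_eq, hw, hv1]
    simp only [map_mul, map_neg, Complex.conj_I]
    ring
  have hn : ∀ v, q v ≠ 0 → Complex.normSq (q v) = 1 := fun v h0 => by
    rcases h.right_root v h0 with h | h | h | h <;> rw [h] <;> simp
  have h4 : Complex.normSq (D.hermAdj v w) = 4 := by
    rw [hH]
    simp only [map_mul, Complex.normSq_conj, hn v hqv, hn w hw0, Complex.normSq_I]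
    norm_num [Complex.normSq_ofNat]
  rcases D.hermAdj_cases v w with h | h | h | h <;> rw [h] at h4 <;> norm_num at h4

/-- With disjoint supports, each vertex has at most one nonzero coordinate, which serves as its
switching phase; isolated vertices get the arbitrary phase `1`. -/
theorem exists_bipartite (h : D.RankTwoDecomposition p q) (h0 : ∀ v, p v ≠ 0 → q v = 0) :
    ∃ l : V → Fin 3, D.FourWaySwitching (bipartiteOfLabel l) ∧
      (∃ v, l v = 0) ∧ ∃ v, l v = 1 := by
  classical
  set l : V → Fin 3 := fun v => if p v ≠ 0 then 0 else if q v ≠ 0 then 1 else 2 with hl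
  set σ : V → ℂ := fun v => if p v ≠ 0 then p v else if q v ≠ 0 then q v else 1 with hσ
  have hσ4 : ∀ v, σ v = 1 ∨ σ v = -1 ∨ σ v = Complex.I ∨ σ v = -Complex.I := by
    intro v
    by_cases h1 : p v = 0
    · by_cases h2 : q v = 0
      · simp [hσ, h1, h2]
      · simpa [hσ, h1, h2] using h.right_root v h2
    · simpa [hσ, h1] using h.left_root v h1
  refine ⟨l, fourWaySwitching_of_hermAdj_eq σ hσ4 ?_, ?_, ?_⟩
  · intro u v
    rw [bipartiteOfLabel_hermAdj]
    refine hermAdj_switch_of_decomposition (P := fun v => ![1, 0, 0] (l v))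
      (Q := fun v => ![0, 1, 0] (l v)) h.hermAdj_eq hσ4 ?_ ?_ u v
    · intro v
      by_cases h1 : p v = 0 <;> by_cases h2 : q v = 0 <;> simp [hσ, hl, h1, h2]
    · intro v
      by_cases h1 : p v = 0
      · by_cases h2 : q v = 0 <;> simp [hσ, hl, h1, h2]
      · simp [hσ, hl, h1, h0 v h1]
  · obtain ⟨v, h1, h2⟩ := h.exists_left
    exact ⟨v, by simp [hl, h1]⟩
  · obtain ⟨v, h1, h2⟩ := h.exists_right
    exact ⟨v, by simp [hl, h1, h2]⟩

theorem exists_cyclic (h : D.RankTwoDecomposition p q)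
    (h0 : ∀ v, p v ≠ 0 → q v ≠ 0 → q v = -Complex.I * p v) (hex : ∃ v, p v ≠ 0 ∧ q v ≠ 0) :
    ∃ l : V → Fin 4, D.FourWaySwitching (cyclicOfLabel l) ∧
      (∃ v, l v = 0) ∧ (∃ v, l v = 1) ∧ ∃ v, l v = 2 := by
  classical
  set l : V → Fin 4 := fun v =>
    if p v ≠ 0 then (if q v ≠ 0 then 2 else 0) else if q v ≠ 0 then 1 else 3 with hl
  -- The phases solve `p = σ P`, `q = σ Q` for the model vectors `P = (1, 0, -1, 0)` and `Q = (0,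
  -- -i, i, 0)`: `P = -1` on label `2` gives `-p`, and `Q = -i` on label `1` gives `i q`.
  set σ : V → ℂ := fun v =>
    if p v ≠ 0 then (if q v ≠ 0 then -p v else p v)
      else if q v ≠ 0 then Complex.I * q v else 1 with hσ
  have hσ4 : ∀ v, σ v = 1 ∨ σ v = -1 ∨ σ v = Complex.I ∨ σ v = -Complex.I := by
    intro v
    by_cases h1 : p v = 0
    · by_cases h2 : q v = 0
      · simp [hσ, h1, h2]
      · rcases h.right_root v h2 with h3 | h3 | h3 | h3 <;> simp [hσ, h1, h3]
    · by_cases h2 : q v = 0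
      · simpa [hσ, h1, h2] using h.left_root v h1
      · rcases h.left_root v h1 with h3 | h3 | h3 | h3 <;> simp [hσ, h2, h3]
  refine ⟨l, fourWaySwitching_of_hermAdj_eq σ hσ4 ?_, ?_, ?_, ?_⟩
  · intro u v
    rw [cyclicOfLabel_hermAdj]
    refine hermAdj_switch_of_decomposition (P := fun v => ![1, 0, -1, 0] (l v))
      (Q := fun v => ![0, -Complex.I, Complex.I, 0] (l v)) h.hermAdj_eq hσ4 ?_ ?_ u v
    · intro v
      by_cases h1 : p v = 0 <;> by_cases h2 : q v = 0 <;> simp [hσ, hl, h1, h2]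
    · intro v
      by_cases h1 : p v = 0
      · by_cases h2 : q v = 0
        · simp [hσ, hl, h1, h2]
        · simp only [hσ, hl, h1, h2, ne_eq, not_true_eq_false, not_false_eq_true, if_true, if_false]
          simp only [Matrix.cons_val]
          linear_combination q v * Complex.I_sq
      · by_cases h2 : q v = 0
        · simp [hσ, hl, h1, h2]
        · have h3 := h0 v h1 h2
          simp only [hσ, hl, h1, h2, ne_eq, not_false_eq_true, if_true]
          simp only [Matrix.cons_val]
          rw [h3]; ring
  · obtain ⟨v, h1, h2⟩ := h.exists_left
    exact ⟨v, by simp [hl, h1, h2]⟩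
  · obtain ⟨v, h1, h2⟩ := h.exists_right
    exact ⟨v, by simp [hl, h1, h2]⟩
  · obtain ⟨v, h1, h2⟩ := hex
    exact ⟨v, by simp [hl, h1, h2]⟩

theorem exists_label (h : D.RankTwoDecomposition p q) :
    (∃ l : V → Fin 3, D.FourWaySwitching (bipartiteOfLabel l) ∧
      (∃ v, l v = 0) ∧ ∃ v, l v = 1) ∨
    ∃ l : V → Fin 4, D.FourWaySwitching (cyclicOfLabel l) ∧
      (∃ v, l v = 0) ∧ (∃ v, l v = 1) ∧ ∃ v, l v = 2 := by
  by_cases h0 : ∀ v, p v ≠ 0 → q v = 0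
  · exact Or.inl (h.exists_bipartite h0)
  · push Not at h0
    obtain ⟨v, hp, hq⟩ := h0
    right
    rcases h.eq_or_eq hp hq with hv | hv
    · refine h.exists_cyclic (fun w hpw hqw => ?_) ⟨v, hp, hq⟩
      exact (h.eq_or_eq hpw hqw).resolve_right fun hw => h.not_and hv hp hw hqw
    -- The other sign reduces to the first by exchanging `p` and `q`.
    · refine h.symm.exists_cyclic (fun w hqw hpw => ?_) ⟨v, hq, hp⟩
      exact (h.eq_or_eq hpw hqw).resolve_left fun hw => h.not_and hw hpw hv hq

end RankTwoDecomposition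

/-- The endpoints of the chosen edge witness the two support conditions: `H u u = 0` kills `q` at
`u`, and `H v v = 0` kills `p` at `v`. -/
theorem exists_rankTwoDecomposition [Fintype V] (D : MixedGraph V) (h : D.hRank = 2) :
    ∃ p q : V → ℂ, D.RankTwoDecomposition p q := by
  obtain ⟨u, v, huv⟩ := D.exists_hermAdj_ne_zero h
  have hvu : D.hermAdj v u ≠ 0 := by rw [← D.hermAdj_isHermitian.apply]; simpa using huv
  refine ⟨fun w => D.hermAdj w v * conj (D.hermAdj u v), fun w => D.hermAdj w u,
    D.hermAdj_eq_of_hRank_eq_two h huv, fun w hw => ?_, fun w hw => ?_,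
    ⟨u, by simp [huv], D.hermAdj_self u⟩, ⟨v, by simp [hermAdj_self], hvu⟩⟩
  · have h1 := (D.hermAdj_cases w v).resolve_left (left_ne_zero_of_mul hw)
    have h2 := (D.hermAdj_cases u v).resolve_left huv
    rcases h1 with h1 | h1 | h1 <;> rcases h2 with h2 | h2 | h2 <;> simp [h1, h2]
  · have h1 := (D.hermAdj_cases w u).resolve_left hw
    tauto

end MixedGraph

/-- Two labellings with fibres of equal sizes differ by a bijection. -/
theorem exists_equiv_of_card_fiber_eq {V W K : Type*} [Fintype V] [Fintype W] [DecidableEq K]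
    (f : V → K) (g : W → K)
    (h : ∀ k, (Finset.univ.filter fun v => f v = k).card =
      (Finset.univ.filter fun w => g w = k).card) :
    ∃ e : V ≃ W, ∀ v, g (e v) = f v := by
  have e : ∀ k, {v // f v = k} ≃ {w // g w = k} := fun k =>
    (Fintype.card_eq.1 (by rw [Fintype.card_subtype, Fintype.card_subtype, h])).some
  refine ⟨(Equiv.sigmaFiberEquiv f).symm.trans ((Equiv.sigmaCongrRight e).trans
    (Equiv.sigmaFiberEquiv g)), fun v => ?_⟩
  exact (e (f v) ⟨v, rfl⟩).2

/-! ### Labelled models as the named graphs, and sorting the parts -/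

namespace MixedGraph

variable {V W : Type*}

theorem ext_of_iff {D D' : MixedGraph V}
    (h1 : ∀ u v, D.undirected.Adj u v ↔ D'.undirected.Adj u v)
    (h2 : ∀ u v, D.arc u v ↔ D'.arc u v) : D = D' := by
  obtain ⟨G, r, _, _⟩ := D
  obtain ⟨G', r', _, _⟩ := D'
  obtain rfl : G = G' := SimpleGraph.ext (by ext u v; exact h1 u v)
  obtain rfl : r = r' := by ext u v; exact h2 u v
  rfl

theorem completeBipartite_addIsolated_eq (a b t : ℕ) :
    (completeBipartite a b).addIsolated t =
      bipartiteOfLabel (Sum.elim (Sum.elim (fun _ => 0) fun _ => 1) fun _ => 2) := by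
  refine ext_of_iff ?_ ?_ <;> rintro ((u | u) | u) ((v | v) | v) <;>
    simp [addIsolated, completeBipartite, bipartiteOfLabel, ofSimpleGraph]

theorem clockwiseTripartite_addIsolated_eq (a b c t : ℕ) :
    (clockwiseTripartite a b c).addIsolated t =
      cyclicOfLabel (Sum.elim (Sum.elim (Sum.elim (fun _ => 0) fun _ => 1) fun _ => 2)
        fun _ => 3) := by
  refine ext_of_iff ?_ ?_
  · rintro (u | u) (v | v) <;> simp [addIsolated, clockwiseTripartite, cyclicOfLabel]
  · rintro (((u | u) | u) | u) (((v | v) | v) | v) <;>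
      first
      | exact iff_of_true trivial (by simp [cyclicOfLabel])
      | exact iff_of_false id (by simp [cyclicOfLabel])

theorem bipartiteOfLabel_isomorphic [Fintype V] (l : V → Fin 3) {a b t : ℕ}
    (h0 : (Finset.univ.filter fun v => l v = 0).card = a)
    (h1 : (Finset.univ.filter fun v => l v = 1).card = b)
    (h2 : (Finset.univ.filter fun v => l v = 2).card = t) :
    (bipartiteOfLabel l).Isomorphic ((completeBipartite a b).addIsolated t) := by
  rw [completeBipartite_addIsolated_eq]
  obtain ⟨e, he⟩ := exists_equiv_of_card_fiber_eq l
    (Sum.elim (Sum.elim (fun _ => 0) fun _ => 1) fun _ => 2 :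
      (Fin a ⊕ Fin b) ⊕ Fin t → Fin 3) (by
    have hk : ∀ k : Fin 3, k = 0 ∨ k = 1 ∨ k = 2 := by decide
    intro k
    rw [Finset.card_filter _ (Finset.univ : Finset ((_ ⊕ _) ⊕ _))]
    simp only [Fintype.sum_sum_type, Sum.elim_inl, Sum.elim_inr]
    rcases hk k with rfl | rfl | rfl <;> simp [h0, h1, h2])
  exact ⟨e, fun u v => by simp only [bipartiteOfLabel, ofSimpleGraph, he], fun u v => Iff.rfl⟩

theorem cyclicOfLabel_isomorphic [Fintype V] (l : V → Fin 4) {a b c t : ℕ}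
    (h0 : (Finset.univ.filter fun v => l v = 0).card = a)
    (h1 : (Finset.univ.filter fun v => l v = 1).card = b)
    (h2 : (Finset.univ.filter fun v => l v = 2).card = c)
    (h3 : (Finset.univ.filter fun v => l v = 3).card = t) :
    (cyclicOfLabel l).Isomorphic ((clockwiseTripartite a b c).addIsolated t) := by
  rw [clockwiseTripartite_addIsolated_eq]
  obtain ⟨e, he⟩ := exists_equiv_of_card_fiber_eq l
    (Sum.elim (Sum.elim (Sum.elim (fun _ => 0) fun _ => 1) fun _ => 2) fun _ => 3 :
      ((Fin a ⊕ Fin b) ⊕ Fin c) ⊕ Fin t → Fin 4) (by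
    have hk : ∀ k : Fin 4, k = 0 ∨ k = 1 ∨ k = 2 ∨ k = 3 := by decide
    intro k
    rw [Finset.card_filter _ (Finset.univ : Finset (((_ ⊕ _) ⊕ _) ⊕ _))]
    simp only [Fintype.sum_sum_type, Sum.elim_inl, Sum.elim_inr]
    rcases hk k with rfl | rfl | rfl | rfl <;> simp [h0, h1, h2, h3])
  exact ⟨e, fun u v => Iff.rfl, fun u v => by simp only [cyclicOfLabel, he]⟩

theorem bipartiteOfLabel_swap (l : V → Fin 3) :
    bipartiteOfLabel (fun v => Equiv.swap 0 1 (l v)) = bipartiteOfLabel l := by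
  refine ext_of_iff (fun u v => ?_) fun u v => Iff.rfl
  simp only [bipartiteOfLabel, ofSimpleGraph]
  generalize l u = i
  generalize l v = j
  revert i j
  decide

/-- A transposition of two parts reverses the cyclic orientation. These two generate all
permutations of the three parts, so taking converses suffices for sorting. -/
theorem cyclicOfLabel_swap (l : V → Fin 4) (s : Equiv.Perm (Fin 4))
    (hs : s = Equiv.swap 0 1 ∨ s = Equiv.swap 1 2) :
    cyclicOfLabel (fun v => s (l v)) = (cyclicOfLabel l).converse := by
  refine ext_of_iff (fun u v => Iff.rfl) fun u v => ?_
  simp only [cyclicOfLabel, converse]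
  generalize l u = i
  generalize l v = j
  revert i j
  rcases hs with rfl | rfl <;> decide

theorem card_filter_perm_apply [Fintype V] {m : ℕ} (l : V → Fin m) (s : Equiv.Perm (Fin m))
    (k : Fin m) : (Finset.univ.filter fun v => s (l v) = k).card =
      (Finset.univ.filter fun v => l v = s.symm k).card := by
  simp only [Equiv.eq_symm_apply]

/-- The parts of a clockwise tripartite digraph can be sorted by size. -/
theorem exists_sorted_cyclicOfLabel [Fintype V] {D : MixedGraph V} (l : V → Fin 4)
    (h : D.SwitchingEquivalent (cyclicOfLabel l))
    (hl : ∀ k : Fin 4, k ≠ 3 → 1 ≤ (Finset.univ.filter fun v => l v = k).card) :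
    ∃ l' : V → Fin 4, D.SwitchingEquivalent (cyclicOfLabel l') ∧
      1 ≤ (Finset.univ.filter fun v => l' v = 0).card ∧
      (Finset.univ.filter fun v => l' v = 0).card ≤
        (Finset.univ.filter fun v => l' v = 1).card ∧
      (Finset.univ.filter fun v => l' v = 1).card ≤
        (Finset.univ.filter fun v => l' v = 2).card := by
  have step : ∀ (l : V → Fin 4) (s : Equiv.Perm (Fin 4)),
      s = Equiv.swap 0 1 ∨ s = Equiv.swap 1 2 → D.SwitchingEquivalent (cyclicOfLabel l) →
      D.SwitchingEquivalent (cyclicOfLabel fun v => s (l v)) := fun l s hs h =>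
    h.tail (Or.inr (cyclicOfLabel_swap l s hs))
  -- Insertion sort: once the first two parts are in order, placing the third takes at most two more
  -- transpositions.
  have main : ∀ l : V → Fin 4, D.SwitchingEquivalent (cyclicOfLabel l) →
      (∀ k : Fin 4, k ≠ 3 → 1 ≤ (Finset.univ.filter fun v => l v = k).card) →
      (Finset.univ.filter fun v => l v = 0).card ≤
        (Finset.univ.filter fun v => l v = 1).card →
      ∃ l' : V → Fin 4, D.SwitchingEquivalent (cyclicOfLabel l') ∧
      1 ≤ (Finset.univ.filter fun v => l' v = 0).card ∧
      (Finset.univ.filter fun v => l' v = 0).card ≤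
        (Finset.univ.filter fun v => l' v = 1).card ∧
      (Finset.univ.filter fun v => l' v = 1).card ≤
        (Finset.univ.filter fun v => l' v = 2).card := by
    intro l h hl h01
    have s0 : (Equiv.swap (1 : Fin 4) 2).symm 0 = 0 := by decide
    have s1 : (Equiv.swap (1 : Fin 4) 2).symm 1 = 2 := by decide
    have s2 : (Equiv.swap (1 : Fin 4) 2).symm 2 = 1 := by decide
    have t0 : (Equiv.swap (0 : Fin 4) 1).symm 0 = 1 := by decide
    have t1 : (Equiv.swap (0 : Fin 4) 1).symm 1 = 0 := by decide
    have t2 : (Equiv.swap (0 : Fin 4) 1).symm 2 = 2 := by decide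
    rcases le_total (Finset.univ.filter fun v => l v = 1).card
      (Finset.univ.filter fun v => l v = 2).card with h12 | h12
    · exact ⟨l, h, hl 0 (by decide), h01, h12⟩
    have h' := step l _ (Or.inr rfl) h
    rcases le_total (Finset.univ.filter fun v => l v = 0).card
      (Finset.univ.filter fun v => l v = 2).card with h02 | h02
    · refine ⟨_, h', ?_⟩
      simp only [card_filter_perm_apply, s0, s1, s2]
      exact ⟨hl 0 (by decide), h02, h12⟩
    · refine ⟨_, step _ _ (Or.inl rfl) h', ?_⟩
      simp only [card_filter_perm_apply, s0, s1, s2, t0, t1, t2]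
      exact ⟨hl 2 (by decide), h02, h01⟩
  rcases le_total (Finset.univ.filter fun v => l v = 0).card
      (Finset.univ.filter fun v => l v = 1).card with h01 | h01
  · exact main l h hl h01
  · refine main _ (step l _ (Or.inl rfl) h) (fun k hk => ?_) ?_
    · rw [card_filter_perm_apply]
      exact hl _ (by revert k; decide)
    · have t0 : (Equiv.swap (0 : Fin 4) 1).symm 0 = 1 := by decide
      have t1 : (Equiv.swap (0 : Fin 4) 1).symm 1 = 0 := by decide
      simpa only [card_filter_perm_apply, t0, t1] using h01

/-- Every mixed graph of `H`-rank 2 is switching equivalent to a complete bipartite graph or to a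
clockwise tripartite digraph, with isolated vertices. -/
theorem exists_switchingEquivalentTo [Fintype V] (D : MixedGraph V) (h : D.hRank = 2) :
    (∃ a b t : ℕ, 1 ≤ a ∧ a ≤ b ∧
      D.SwitchingEquivalentTo ((completeBipartite a b).addIsolated t)) ∨
    ∃ a b c t : ℕ, 1 ≤ a ∧ a ≤ b ∧ b ≤ c ∧
      D.SwitchingEquivalentTo ((clockwiseTripartite a b c).addIsolated t) := by
  have hpos : ∀ {m : ℕ} (l : V → Fin m) (k : Fin m), (∃ v, l v = k) →
      1 ≤ (Finset.univ.filter fun v => l v = k).card := fun l k ⟨v, hv⟩ =>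
    Finset.card_pos.2 ⟨v, by simpa using hv⟩
  obtain ⟨p, q, hpq⟩ := D.exists_rankTwoDecomposition h
  rcases hpq.exists_label with ⟨l, hl, h0, h1⟩ | ⟨l, hl, h0, h1, h2⟩
  · left
    have hs : D.SwitchingEquivalent (bipartiteOfLabel l) := .single (Or.inl hl)
    rcases le_total (Finset.univ.filter fun v => l v = 0).card
      (Finset.univ.filter fun v => l v = 1).card with h01 | h01
    · exact ⟨_, _, _, hpos l 0 h0, h01, _, hs, bipartiteOfLabel_isomorphic l rfl rfl rfl⟩
    · rw [← bipartiteOfLabel_swap] at hs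
      have t0 : (Equiv.swap (0 : Fin 3) 1).symm 0 = 1 := by decide
      have t1 : (Equiv.swap (0 : Fin 3) 1).symm 1 = 0 := by decide
      refine ⟨_, _, _, ?_, ?_, _, hs, bipartiteOfLabel_isomorphic _ rfl rfl rfl⟩ <;>
        simp only [card_filter_perm_apply, t0, t1]
      · exact hpos l 1 h1
      · exact h01
  · right
    obtain ⟨l', hs, ha, hab, hbc⟩ := exists_sorted_cyclicOfLabel l (.single (Or.inl hl)) (by
      have hk : ∀ k : Fin 4, k = 0 ∨ k = 1 ∨ k = 2 ∨ k = 3 := by decide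
      intro k hk3
      rcases hk k with rfl | rfl | rfl | rfl
      exacts [hpos l 0 h0, hpos l 1 h1, hpos l 2 h2, absurd rfl hk3])
    exact ⟨_, _, _, _, ha, hab, hbc, _, hs, cyclicOfLabel_isomorphic l' rfl rfl rfl rfl⟩

/-! ### Invariants of the two families and their disjointness -/

theorem sum_normSq_completeBipartite_addIsolated (a b t : ℕ) :
    ∑ u, ∑ v, Complex.normSq (((completeBipartite a b).addIsolated t).hermAdj u v) =
      2 * (a * b : ℝ) := by
  simp only [completeBipartite_addIsolated_eq, bipartiteOfLabel_hermAdj]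
  simp [Fintype.sum_sum_type]
  ring

theorem sum_normSq_clockwiseTripartite_addIsolated (a b c t : ℕ) :
    ∑ u, ∑ v, Complex.normSq (((clockwiseTripartite a b c).addIsolated t).hermAdj u v) =
      2 * (a * b + b * c + a * c : ℝ) := by
  simp only [clockwiseTripartite_addIsolated_eq, cyclicOfLabel_hermAdj]
  simp [Fintype.sum_sum_type]
  ring

theorem hRank_completeBipartite_addIsolated {a b : ℕ} (t : ℕ) (ha : 1 ≤ a) (hb : 1 ≤ b) :
    ((completeBipartite a b).addIsolated t).hRank = 2 := by
  rw [completeBipartite_addIsolated_eq]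
  refine hRank_eq_two_of_hermAdj_eq _ (u := Sum.inl (Sum.inl ⟨0, ha⟩))
    (v := Sum.inl (Sum.inr ⟨0, hb⟩)) ?_ _ _ (bipartiteOfLabel_hermAdj _)
  simp [bipartiteOfLabel_hermAdj]

theorem hRank_clockwiseTripartite_addIsolated {a b : ℕ} (c t : ℕ) (ha : 1 ≤ a) (hb : 1 ≤ b) :
    ((clockwiseTripartite a b c).addIsolated t).hRank = 2 := by
  rw [clockwiseTripartite_addIsolated_eq]
  refine hRank_eq_two_of_hermAdj_eq _ (u := Sum.inl (Sum.inl (Sum.inl ⟨0, ha⟩)))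
    (v := Sum.inl (Sum.inl (Sum.inr ⟨0, hb⟩))) ?_ _ _ (cyclicOfLabel_hermAdj _)
  simp [cyclicOfLabel_hermAdj]

theorem SwitchingEquivalentTo.card_eq_and_sum_eq [Fintype V] [Fintype W] {D : MixedGraph V}
    {F : MixedGraph W} (h : D.SwitchingEquivalentTo F) :
    Fintype.card V = Fintype.card W ∧
      ∑ u, ∑ v, Complex.normSq (D.hermAdj u v) = ∑ u, ∑ v, Complex.normSq (F.hermAdj u v) := by
  obtain ⟨e, he⟩ := h.normSq_hermAdj
  refine ⟨Fintype.card_congr e, ?_⟩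
  simp only [he]
  rw [← e.sum_comp]
  exact Finset.sum_congr rfl fun u _ => e.sum_comp fun v => Complex.normSq (F.hermAdj (e u) v)

/-- A bipartite graph has no triangles, so the two types of mixed graphs of `H`-rank 2 are not
switching equivalent. -/
theorem not_switchingEquivalentTo_both {D : MixedGraph V} {a b t a' b' c' t' : ℕ}
    (h : D.SwitchingEquivalentTo ((completeBipartite a b).addIsolated t))
    (h' : D.SwitchingEquivalentTo ((clockwiseTripartite a' b' c').addIsolated t'))
    (ha : 1 ≤ a') (hb : 1 ≤ b') (hc : 1 ≤ c') : False := by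
  rw [completeBipartite_addIsolated_eq] at h
  rw [clockwiseTripartite_addIsolated_eq] at h'
  obtain ⟨e, he⟩ := h.normSq_hermAdj
  obtain ⟨f, hf⟩ := h'.normSq_hermAdj
  -- One vertex from each tripartite part yields a triangle, carried through `V` into the bipartite
  -- copy.
  have h1 := he (f.symm (Sum.inl (Sum.inl (Sum.inl ⟨0, ha⟩))))
    (f.symm (Sum.inl (Sum.inl (Sum.inr ⟨0, hb⟩))))
  have h2 := he (f.symm (Sum.inl (Sum.inl (Sum.inr ⟨0, hb⟩)))) (f.symm (Sum.inl (Sum.inr ⟨0, hc⟩)))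
  have h3 := he (f.symm (Sum.inl (Sum.inr ⟨0, hc⟩))) (f.symm (Sum.inl (Sum.inl (Sum.inl ⟨0, ha⟩))))
  rw [hf, Equiv.apply_symm_apply, Equiv.apply_symm_apply, bipartiteOfLabel_hermAdj,
    cyclicOfLabel_hermAdj] at h1 h2 h3
  revert h1 h2 h3
  generalize e (f.symm (Sum.inl (Sum.inl (Sum.inl ⟨0, ha⟩)))) = x
  generalize e (f.symm (Sum.inl (Sum.inl (Sum.inr ⟨0, hb⟩)))) = y
  generalize e (f.symm (Sum.inl (Sum.inr ⟨0, hc⟩))) = z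
  -- Whatever parts `x`, `y`, `z` lie in, some pair among them is nonadjacent.
  rcases x with (x | x) | x <;> rcases y with (y | y) | y <;> rcases z with (z | z) | z <;> simp

end MixedGraph

theorem mainTheorem3 :
    -- the classification
    (∀ {V : Type*} [Fintype V] (D : MixedGraph V), D.hRank = 2 →
      ∃ ρ : ℝ, D.IsThePositiveEigenvalue ρ ∧
        Xor
          (∃ a b t : ℕ, 1 ≤ a ∧ a ≤ b ∧
            D.SwitchingEquivalentTo ((MixedGraph.completeBipartite a b).addIsolated t))
          (∃ a b c t : ℕ, 1 ≤ a ∧ a ≤ b ∧ b ≤ c ∧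
            D.SwitchingEquivalentTo ((MixedGraph.clockwiseTripartite a b c).addIsolated t)) ∧
        (∀ a b t : ℕ, 1 ≤ a → a ≤ b →
          D.SwitchingEquivalentTo ((MixedGraph.completeBipartite a b).addIsolated t) →
          Fintype.card V = a + b + t ∧ ρ ^ 2 = (a * b : ℝ)) ∧
        (∀ a b c t : ℕ, 1 ≤ a → a ≤ b → b ≤ c →
          D.SwitchingEquivalentTo ((MixedGraph.clockwiseTripartite a b c).addIsolated t) →
          Fintype.card V = a + b + c + t ∧ ρ ^ 2 = (a * b + b * c + a * c : ℝ))) ∧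
    -- the converse for the complete bipartite graphs
    (∀ a b t : ℕ, 1 ≤ a → a ≤ b →
      ((MixedGraph.completeBipartite a b).addIsolated t).hRank = 2 ∧
      Fintype.card ((Fin a ⊕ Fin b) ⊕ Fin t) = a + b + t ∧
      ∃ ρ : ℝ, ((MixedGraph.completeBipartite a b).addIsolated t).IsThePositiveEigenvalue ρ ∧
        ρ ^ 2 = (a * b : ℝ)) ∧
    -- the converse for the clockwise complete tripartite digraphs
    (∀ a b c t : ℕ, 1 ≤ a → a ≤ b → b ≤ c →
      ((MixedGraph.clockwiseTripartite a b c).addIsolated t).hRank = 2 ∧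
      Fintype.card (((Fin a ⊕ Fin b) ⊕ Fin c) ⊕ Fin t) = a + b + c + t ∧
      ∃ ρ : ℝ, ((MixedGraph.clockwiseTripartite a b c).addIsolated t).IsThePositiveEigenvalue ρ ∧
        ρ ^ 2 = (a * b + b * c + a * c : ℝ)) := by
  refine ⟨fun {V} _ D hD => ?_, fun a b t ha hab => ?_, fun a b c t ha hab hbc => ?_⟩
  · obtain ⟨ρ, hρ, hsum⟩ := D.exists_isThePositiveEigenvalue hD
    refine ⟨ρ, hρ, ?_, fun a b t _ _ h => ?_, fun a b c t _ _ _ h => ?_⟩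
    · rcases D.exists_switchingEquivalentTo hD with h1 | h2
      · refine Or.inl ⟨h1, ?_⟩
        rintro ⟨a', b', c', t', ha', hab', hbc', h'⟩
        obtain ⟨a, b, t, -, -, h⟩ := h1
        exact MixedGraph.not_switchingEquivalentTo_both h h' ha' (ha'.trans hab')
          ((ha'.trans hab').trans hbc')
      · refine Or.inr ⟨h2, ?_⟩
        rintro ⟨a, b, t, -, -, h⟩
        obtain ⟨a', b', c', t', ha', hab', hbc', h'⟩ := h2
        exact MixedGraph.not_switchingEquivalentTo_both h h' ha' (ha'.trans hab')
          ((ha'.trans hab').trans hbc')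
    · obtain ⟨hc, hs⟩ := h.card_eq_and_sum_eq
      rw [MixedGraph.sum_normSq_completeBipartite_addIsolated] at hs
      -- Both `2ρ²` and twice the number of edges of the model equal the same invariant sum.
      exact ⟨by simpa using hc, by linarith⟩
    · obtain ⟨hc, hs⟩ := h.card_eq_and_sum_eq
      rw [MixedGraph.sum_normSq_clockwiseTripartite_addIsolated] at hs
      exact ⟨by simpa using hc, by linarith⟩
  · have h2 := MixedGraph.hRank_completeBipartite_addIsolated t ha (ha.trans hab)
    obtain ⟨ρ, hρ, hsum⟩ := MixedGraph.exists_isThePositiveEigenvalue _ h2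
    rw [MixedGraph.sum_normSq_completeBipartite_addIsolated] at hsum
    exact ⟨h2, by simp, ρ, hρ, by linarith⟩
  · have h2 := MixedGraph.hRank_clockwiseTripartite_addIsolated c t ha (ha.trans hab)
    obtain ⟨ρ, hρ, hsum⟩ := MixedGraph.exists_isThePositiveEigenvalue _ h2
    rw [MixedGraph.sum_normSq_clockwiseTripartite_addIsolated] at hsum
    exact ⟨h2, by simp, ρ, hρ, by linarith⟩
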